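/- Conventions. All ultrafilters are non-principal ultrafilters over countable index sets $I$. Given metric spaces $(X_n,\mathrm{dist}_n)_{n\in I}$, an ultrafilter $\omega$ over $I$ and an observation point $e=(e_n)\in\prod_n X_n$, the ultralimit $\lim^\omega(X_n,\mathrm{dist}_n)_e$ is the metric space obtained from the set of all sequences $(x_n)\in\prod_n X_n$ with $\lim_\omega \mathrm{dist}_n(x_n,e_n)<\infty$, with the pseudo-metric $D(x,y)=\lim_\omega \mathrm{dist}_n(x_n,y_n)$, by identifying $x$ and $y$ whenever $D(x,y)=0$. An asymptotic cone of a metric space $(X,\mathrm{dist})$ is an ultralimit $\lim^\omega(X,\frac1{d_n}\mathrm{dist})_e$, where $d_n>0$ are scaling constants with $\lim_\omega d_n=\infty$ and $e\in X^I$ is arbitrary. A point of a space is a (global) cut-point if its complement is not connected; by convention a one-point space has a cut-point. A finitely generated group is regarded as a metric space with the word metric $\mathrm{dist}_S(a,b)=|a^{-1}b|_S$ of a finite generating set $S$. A group is virtually cyclic if it has a cyclic subgroup of finite index. Theorem. (1) Let $G$ be a finitely generated group that is not virtually cyclic and has a central infinite cyclic subgroup. Then $G$ is wide: for every finite generating set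 $S$ of $G$, no asymptotic cone of $(G,\mathrm{dist}_S)$ has a cut-point. (2) Let $\mathcal G$ be the family of all finitely generated groups that are not virtually cyclic and have a central infinite cyclic subgroup, each endowed with any of its word metrics with respect to finite generating sets. Then $\mathcal G$ is uniformly unconstricted: for every sequence $(G_n,\mathrm{dist}_n)_{n\in I}$ of members of $\mathcal G$, indexed by a countably infinite set $I$, there exist an ultrafilter $\omega$ over $I$ and scaling constants $d_n>0$ with $\lim_\omega d_n=\infty$ such that for every sequence of base-points $b_n\in G_n$ the ultralimit $\lim^\omega(G_n,\frac1{d_n}\mathrm{dist}_n)_b$ has no cut-point. -/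

import Mathlib

open Filter Topology

universe u

noncomputable section

namespace AsympCone

/-! ### Ultralimits of metric spaces -/

/-- Non-principal ultrafilters: no finite set belongs to `ω`. -/
def NonPrincipal {I : Type} (ω : Ultrafilter I) : Prop :=
  ∀ s : Set I, s.Finite → s ∉ ω

/-- Sequences at finite distance from the observation point `e`: the `ω`-limit of
`dist (x i) (e i)` in `[0, ∞]` is finite exactly when these distances are `ω`-almost surely
bounded by a constant. -/
def FiniteSeq {I : Type} (ω : Ultrafilter I) (X : I → Type u) [∀ i, MetricSpace (X i)]
    (e : ∀ i, X i) : Type u :=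
  {x : ∀ i, X i // ∃ C : ℝ, ∀ᶠ i in (ω : Filter I), dist (x i) (e i) ≤ C}

section

variable {I : Type} {ω : Ultrafilter I} {X : I → Type u} [∀ i, MetricSpace (X i)] {e : ∀ i, X i}

/-- `D(x, y) = lim_ω dist (x i) (y i)`. -/
def ultraDist (x y : FiniteSeq ω X e) : ℝ :=
  limUnder (ω : Filter I) fun i => dist (x.1 i) (y.1 i)

/-- The limit defining `ultraDist` exists. -/
theorem tendsto_ultraDist (x y : FiniteSeq ω X e) :
    Tendsto (fun i => dist (x.1 i) (y.1 i)) (ω : Filter I) (𝓝 (ultraDist x y)) := by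
  obtain ⟨C, hC⟩ := x.2
  obtain ⟨C', hC'⟩ := y.2
  have h : ∀ᶠ i in (ω : Filter I), dist (x.1 i) (y.1 i) ∈ Set.Icc (0 : ℝ) (C + C') := by
    filter_upwards [hC, hC'] with i h1 h2
    exact ⟨dist_nonneg, (dist_triangle_right _ _ (e i)).trans (add_le_add h1 h2)⟩
  obtain ⟨a, -, ha⟩ := isCompact_Icc.ultrafilter_le_nhds
    (ω.map fun i => dist (x.1 i) (y.1 i)) (le_principal_iff.2 h)
  exact tendsto_nhds_limUnder ⟨a, ha⟩

instance : PseudoMetricSpace (FiniteSeq ω X e) where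
  dist := ultraDist
  dist_self x := by
    refine tendsto_nhds_unique (tendsto_ultraDist x x) ?_
    simp
  dist_comm x y := by
    refine tendsto_nhds_unique (tendsto_ultraDist x y) ?_
    simpa only [dist_comm] using tendsto_ultraDist y x
  dist_triangle x y z :=
    le_of_tendsto_of_tendsto' (tendsto_ultraDist x z)
      ((tendsto_ultraDist x y).add (tendsto_ultraDist y z)) fun _ => dist_triangle _ _ _

end

/-- The `ω`-limit of the metric spaces `X i` relative to the observation point `e`: sequences
at finite distance from `e`, two sequences being identified when `D(x, y) = 0`. (Sequences which
agree `ω`-almost surely have `D(x, y) = 0`.) -/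
abbrev Ultralimit {I : Type} (ω : Ultrafilter I) (X : I → Type u) [∀ i, MetricSpace (X i)]
    (e : ∀ i, X i) : Type u :=
  SeparationQuotient (FiniteSeq ω X e)

/-- The metric space `(X, dist / d)`. -/
def Rescaled (X : Type u) (_d : {r : ℝ // 0 < r}) : Type u := X

/-- A point of `X`, seen in `(X, dist / d)`. -/
def Rescaled.mk {X : Type u} (d : {r : ℝ // 0 < r}) (x : X) : Rescaled X d := x

instance (X : Type u) [MetricSpace X] (d : {r : ℝ // 0 < r}) : MetricSpace (Rescaled X d) where
  dist x y := dist (α := X) x y / d.1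
  dist_self x := div_eq_zero_iff.2 (Or.inl (dist_self (α := X) x))
  dist_comm x y := congrArg (· / d.1) (dist_comm (α := X) x y)
  dist_triangle x y z := by
    rw [← add_div]
    exact div_le_div_of_nonneg_right (dist_triangle (α := X) x y z) d.2.le
  eq_of_dist_eq_zero {x y} h := by
    rcases div_eq_zero_iff.1 h with h | h
    · exact eq_of_dist_eq_zero (γ := X) h
    · exact absurd h d.2.ne'

/-- The `ω`-limit of the rescaled spaces `(X i, dist / d i)` with respect to `e`. -/
abbrev ScaledUltralimit {I : Type} (ω : Ultrafilter I) (X : I → Type u) [∀ i, MetricSpace (X i)]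
    (e : ∀ i, X i) (d : I → {r : ℝ // 0 < r}) : Type u :=
  Ultralimit ω (fun i => Rescaled (X i) (d i)) fun i => Rescaled.mk (d i) (e i)

/-- The asymptotic cone of `X` with respect to `ω`, the observation point `e` and the scaling
constants `d`. -/
abbrev Cone {I : Type} (ω : Ultrafilter I) (X : Type u) [MetricSpace X]
    (e : I → X) (d : I → {r : ℝ // 0 < r}) : Type u :=
  ScaledUltralimit ω (fun _ => X) e d

/-- The scaling constants tend to infinity along `ω`. -/
def ScalingTendsto {I : Type} (ω : Ultrafilter I) (d : I → {r : ℝ // 0 < r}) : Prop :=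
  Tendsto (fun i => (d i : ℝ)) (ω : Filter I) atTop

/-! ### Cut-points, wide spaces, uniformly unconstricted families -/

/-- A space has a (global) cut-point if removing some point disconnects it; by convention,
a one-point space has a cut-point. -/
def HasCutPoint (Y : Type u) [TopologicalSpace Y] : Prop :=
  Subsingleton Y ∨ ∃ y : Y, ¬ IsPreconnected ({y}ᶜ : Set Y)

/-- A metric space is wide if none of its asymptotic cones has a cut-point. -/
def Wide (X : Type u) [MetricSpace X] : Prop :=
  ∀ (I : Type) [Countable I] (ω : Ultrafilter I), NonPrincipal ω →
    ∀ d : I → {r : ℝ // 0 < r}, ScalingTendsto ω d →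
      ∀ e : I → X, ¬ HasCutPoint (Cone ω X e d)

/-- A bundled metric space. -/
structure MetricSp : Type (u + 1) where
  carrier : Type u
  [metric : MetricSpace carrier]

instance (B : MetricSp.{u}) : MetricSpace B.carrier := B.metric

/-- A family of metric spaces is uniformly unconstricted if for every sequence in the family
there are an ultrafilter and scaling constants such that, for every choice of base-points, the
ultralimit of the rescaled spaces has no cut-point. -/
def UniformlyUnconstricted (𝓑 : Set MetricSp.{u}) : Prop :=
  ∀ (I : Type) [Countable I] [Infinite I] (B : I → MetricSp.{u}), (∀ i, B i ∈ 𝓑) →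
    ∃ ω : Ultrafilter I, NonPrincipal ω ∧
      ∃ d : I → {r : ℝ // 0 < r}, ScalingTendsto ω d ∧
        ∀ b : ∀ i, (B i).carrier,
          ¬ HasCutPoint (ScaledUltralimit ω (fun i => (B i).carrier) b d)

/-! ### Finitely generated groups as metric spaces -/

section Word

variable {G : Type u} [Group G]

/-- `l` is a group word in `S` (a word in `S ∪ S⁻¹`) which represents `g`. -/
def IsWordFor (S : Set G) (g : G) (l : List G) : Prop :=
  (∀ x ∈ l, x ∈ S ∨ x⁻¹ ∈ S) ∧ l.prod = g

/-- The length of a shortest group word in `S` representing `g`. -/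
def wordLength (S : Set G) (g : G) : ℕ :=
  sInf {n : ℕ | ∃ l : List G, IsWordFor S g l ∧ l.length = n}

theorem exists_word {S : Set G} (hS : Subgroup.closure S = ⊤) (g : G) :
    ∃ l : List G, IsWordFor S g l ∧ l.length = wordLength S g := by
  have hne : {n : ℕ | ∃ l : List G, IsWordFor S g l ∧ l.length = n}.Nonempty := by
    have hg : g ∈ (Subgroup.closure S).toSubmonoid := hS ▸ Subgroup.mem_top g
    rw [Subgroup.closure_toSubmonoid] at hg
    obtain ⟨l, hl, hp⟩ := Submonoid.exists_list_of_mem_closure hg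
    exact ⟨l.length, l, ⟨hl, hp⟩, rfl⟩
  exact Nat.sInf_mem hne

theorem wordLength_le {S : Set G} {g : G} {l : List G} (h : IsWordFor S g l) :
    wordLength S g ≤ l.length :=
  Nat.sInf_le ⟨l, h, rfl⟩

theorem wordLength_inv_le {S : Set G} (hS : Subgroup.closure S = ⊤) (g : G) :
    wordLength S g⁻¹ ≤ wordLength S g := by
  obtain ⟨l, ⟨hl, hp⟩, hn⟩ := exists_word hS g
  have h : IsWordFor S g⁻¹ (l.map fun x => x⁻¹).reverse := by
    refine ⟨fun x hx => ?_, by rw [← List.prod_inv_reverse, hp]⟩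
    obtain ⟨y, hy, rfl⟩ := List.mem_map.1 (List.mem_reverse.1 hx)
    rw [inv_inv]
    exact (hl y hy).symm
  have := wordLength_le h
  rw [List.length_reverse, List.length_map, hn] at this
  exact this

theorem wordLength_mul_le {S : Set G} (hS : Subgroup.closure S = ⊤) (g h : G) :
    wordLength S (g * h) ≤ wordLength S g + wordLength S h := by
  obtain ⟨l, ⟨hl, hp⟩, hn⟩ := exists_word hS g
  obtain ⟨l', ⟨hl', hp'⟩, hn'⟩ := exists_word hS h
  have : IsWordFor S (g * h) (l ++ l') := by
    refine ⟨fun x hx => ?_, by rw [List.prod_append, hp, hp']⟩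
    rcases List.mem_append.1 hx with hx | hx
    · exact hl x hx
    · exact hl' x hx
  have := wordLength_le this
  rw [List.length_append, hn, hn'] at this
  exact this

/-- The word metric on a group with respect to a generating set `S`:
`dist a b` is the word length of `a⁻¹ * b`. -/
@[reducible] def wordMetric (S : Set G) (hS : Subgroup.closure S = ⊤) : MetricSpace G where
  dist a b := wordLength S (a⁻¹ * b)
  dist_self a := by
    have h : wordLength S (1 : G) ≤ 0 := wordLength_le (l := []) ⟨by simp, rfl⟩
    simpa using h
  dist_comm a b := by
    have h1 := wordLength_inv_le hS (a⁻¹ * b)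
    have h2 := wordLength_inv_le hS (b⁻¹ * a)
    rw [mul_inv_rev, inv_inv] at h1 h2
    exact_mod_cast le_antisymm h2 h1
  dist_triangle a b c := by
    have h := wordLength_mul_le hS (a⁻¹ * b) (b⁻¹ * c)
    rw [mul_assoc, mul_inv_cancel_left] at h
    exact_mod_cast h
  eq_of_dist_eq_zero {a b} h := by
    have h0 : wordLength S (a⁻¹ * b) = 0 := by exact_mod_cast h
    obtain ⟨l, ⟨-, hp⟩, hn⟩ := exists_word hS (a⁻¹ * b)
    rw [h0, List.length_eq_zero_iff] at hn
    subst hn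
    rw [List.prod_nil] at hp
    exact (inv_mul_eq_one.1 hp.symm)

end Word

/-- A group is virtually cyclic if it has a cyclic subgroup of finite index. -/
def VirtuallyCyclic (G : Type u) [Group G] : Prop :=
  ∃ H : Subgroup G, IsCyclic H ∧ H.FiniteIndex

/-- The group has a central infinite cyclic subgroup. -/
def HasCentralInfiniteCyclic (G : Type u) [Group G] : Prop :=
  ∃ H : Subgroup G, H ≤ Subgroup.center G ∧ IsCyclic H ∧ Infinite H

/-- A finitely generated group is wide if it is wide for the word metric of every finite
generating set. -/
def WideGroup (G : Type u) [Group G] : Prop :=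
  ∀ (S : Set G) (_ : S.Finite) (hS : Subgroup.closure S = ⊤), @Wide G (wordMetric S hS)

/-- The family of all finitely generated groups which are not virtually cyclic and have a central
infinite cyclic subgroup, each equipped with any of its word metrics with respect to finite
generating sets. -/
def centralFamily : Set MetricSp.{u} :=
  {B | ∃ (G : Type u) (_ : Group G) (S : Set G) (_ : S.Finite)
      (hS : Subgroup.closure S = ⊤),
      ¬ VirtuallyCyclic G ∧ HasCentralInfiniteCyclic G ∧
        B = @MetricSp.mk G (wordMetric S hS)}

end AsympCone

end

/-!
A cut-point `p` of a geodesic space splits the space into two sides `A` and `B` such that every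
geodesic from `A` to `B` passes through `p`. Let `φ` be an isometry moving every point by the same
distance `r`, and suppose that `x ∈ A` and `z ∈ B` are at distance `r` from `p`. If `φ p ∈ B`, then
`φ x = p`: for `φ x ∈ A` the distance `dist (φ x) (φ p) = r` would exceed `dist p (φ p) = r`, and
for `φ x ∈ B` the distance `dist x (φ x) = r` would exceed `dist x p = r`. By symmetry, in all
cases `x` is `φ p` or `φ⁻¹ p`. Hence there is no cut-point if, for all `r > 0`, there is such a `φ`
and every sphere of radius `r` has a point which is neither image of the centre.

In an ultralimit of groups, right multiplication by a central sequence `h` coincides with left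
multiplication, which is an isometry, and moves every point by `lim dist 1 (h i)`. Powers of central
elements of infinite order and vanishing length realize all `r > 0`. Points of a sphere outside the
orbit come from elements of the groups at distance about `r` both from `1` and from the central
cyclic subgroup, which exist because this subgroup has infinite index.
-/

namespace AsympCone

section RoughGeodesics

variable {C : Type*} {δ : ℝ}

/-- Any two points are joined by a path which is parametrized proportionally to arc length up to an
additive error `δ`; for `δ = 0` this is a geodesic space. Paths are defined on the whole line
instead of the unit interval, which is no restriction since they may be constant outside of it. -/
def IsRoughlyGeodesic (δ : ℝ) (C : Type*) [PseudoMetricSpace C] : Prop :=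
  ∀ x y : C, ∃ γ : ℝ → C, γ 0 = x ∧ γ 1 = y ∧ ∀ s t, dist (γ s) (γ t) ≤ |s - t| * dist x y + δ

theorem IsRoughlyGeodesic.exists_between [PseudoMetricSpace C] (hC : IsRoughlyGeodesic δ C)
    (x y : C) {r : ℝ} (h0 : 0 ≤ r) (hr : r ≤ dist x y) :
    ∃ z, dist x z ≤ r + δ ∧ dist z y ≤ dist x y - r + δ := by
  obtain ⟨γ, hγ0, hγ1, hγ⟩ := hC x y
  have hmul : r / dist x y * dist x y = r :=
    div_mul_cancel_of_imp fun h => le_antisymm (h ▸ hr) h0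
  have hle : r / dist x y ≤ 1 := div_le_one_of_le₀ hr dist_nonneg
  refine ⟨γ (r / dist x y), ?_, ?_⟩
  · simpa [hγ0, abs_of_nonneg (div_nonneg h0 dist_nonneg), hmul] using hγ 0 (r / dist x y)
  · simpa [hγ1, abs_sub_comm _ (1 : ℝ), abs_of_nonneg (sub_nonneg.2 hle), sub_mul, hmul]
      using hγ (r / dist x y) 1

theorem IsRoughlyGeodesic.dist_eq_add_of_forall_isPreconnected [PseudoMetricSpace C]
    (hC : IsRoughlyGeodesic 0 C) {p x y : C}
    (hp : ∀ K : Set C, IsPreconnected K → x ∈ K → y ∈ K → p ∈ K) :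
    dist x y = dist x p + dist p y := by
  obtain ⟨γ, rfl, rfl, hγ⟩ := hC x y
  simp only [add_zero] at hγ
  have hcont : Continuous γ :=
    (LipschitzWith.of_dist_le_mul (K := ⟨dist (γ 0) (γ 1), dist_nonneg⟩) fun s t => by
      rw [Real.dist_eq, mul_comm]; exact hγ s t).continuous
  obtain ⟨t, ⟨ht0, ht1⟩, rfl⟩ : p ∈ γ '' Set.Icc 0 1 :=
    hp _ (isPreconnected_Icc.image _ hcont.continuousOn) ⟨0, by simp⟩ ⟨1, by simp⟩
  refine le_antisymm (dist_triangle _ _ _) ?_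
  calc dist (γ 0) (γ t) + dist (γ t) (γ 1)
      ≤ |0 - t| * dist (γ 0) (γ 1) + |t - 1| * dist (γ 0) (γ 1) := add_le_add (hγ 0 t) (hγ t 1)
    _ = dist (γ 0) (γ 1) := by
      rw [zero_sub, abs_neg, abs_of_nonneg ht0, abs_of_nonpos (sub_nonpos.2 ht1)]
      ring

end RoughGeodesics

section CutPoints

variable {C : Type u} [MetricSpace C] {p x y z : C} {A B : Set C}

/-- The space is the metric wedge of `A ∪ {p}` and `B ∪ {p}` at `p`. This is how a cut-point of a
geodesic space is seen by the metric. -/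
structure IsMetricWedge (p : C) (A B : Set C) : Prop where
  union_eq : A ∪ B = {p}ᶜ
  dist_eq : ∀ x ∈ A, ∀ y ∈ B, dist x y = dist x p + dist p y

theorem IsMetricWedge.symm (h : IsMetricWedge p A B) : IsMetricWedge p B A where
  union_eq := by rw [Set.union_comm, h.union_eq]
  dist_eq x hx y hy := by
    rw [dist_comm, h.dist_eq y hy x hx, add_comm, dist_comm p x, dist_comm y p]

theorem IsMetricWedge.mem_or_mem (h : IsMetricWedge p A B) (hx : x ≠ p) : x ∈ A ∨ x ∈ B :=
  h.union_eq.ge hx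

theorem IsRoughlyGeodesic.exists_isMetricWedge (hC : IsRoughlyGeodesic 0 C)
    (hp : ¬ IsPreconnected ({p}ᶜ : Set C)) :
    ∃ A B : Set C, IsMetricWedge p A B ∧ A.Nonempty ∧ B.Nonempty := by
  rw [IsPreconnected] at hp
  push Not at hp
  obtain ⟨U, V, hU, hV, hcov, hUne, hVne, hdisj⟩ := hp
  refine ⟨{p}ᶜ ∩ U, {p}ᶜ ∩ V, ⟨?_, fun x hx y hy => ?_⟩, hUne, hVne⟩
  · rw [← Set.inter_union_distrib_left, Set.inter_eq_left.2 hcov]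
  · refine hC.dist_eq_add_of_forall_isPreconnected fun K hK hxK hyK => ?_
    by_contra hpK
    have hKp : K ⊆ {p}ᶜ := Set.subset_compl_singleton_iff.2 hpK
    obtain ⟨z, hzK, hzUV⟩ := hK U V hU hV (hKp.trans hcov) ⟨x, hxK, hx.2⟩ ⟨y, hyK, hy.2⟩
    exact hdisj.le ⟨hKp hzK, hzUV⟩

theorem IsMetricWedge.exists_mem_dist_eq (h : IsMetricWedge p A B) (hC : IsRoughlyGeodesic 0 C)
    (hy : y ∈ B) {r : ℝ} (h0 : 0 < r) (hr : r ≤ dist p y) : ∃ z ∈ B, dist p z = r := by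
  obtain ⟨z, hpz, hzy⟩ := hC.exists_between p y h0.le hr
  have htri := dist_triangle p z y
  have hz : dist p z = r := by linarith
  refine ⟨z, (h.mem_or_mem ?_).resolve_left fun hzA => ?_, hz⟩
  · rintro rfl
    exact h0.ne (by rw [← hz, dist_self])
  · have hzpy := h.dist_eq z hzA y hy
    rw [dist_comm z p] at hzpy
    linarith

theorem IsMetricWedge.apply_eq (h : IsMetricWedge p A B) {φ : C → C} (hφ : Isometry φ)
    (hdispl : ∀ w, dist w (φ w) = dist p x) (hx : x ∈ A) (hp : φ p ∈ B) : φ x = p := by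
  by_contra hne
  rcases h.mem_or_mem hne with hA | hB
  · have hdist := h.dist_eq _ hA _ hp
    rw [hφ.dist_eq, hdispl, dist_comm x] at hdist
    exact hne (dist_eq_zero.1 (by linarith))
  · have hdist := h.dist_eq _ hx _ hB
    rw [hdispl, dist_comm x] at hdist
    exact hne (dist_eq_zero.1 (by rw [dist_comm]; linarith))

theorem IsMetricWedge.apply_eq_or_symm_apply_eq (h : IsMetricWedge p A B) (hx : x ∈ A)
    (hz : z ∈ B) (hxz : dist p z = dist p x) (hpx : 0 < dist p x) (φ : C ≃ᵢ C)
    (hdispl : ∀ w, dist w (φ w) = dist p x) : φ p = x ∨ φ.symm p = x := by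
  have hdispl' (w : C) : dist w (φ.symm w) = dist p x := by
    rw [dist_comm, ← hdispl (φ.symm w), φ.apply_symm_apply]
  have hφp : φ p ≠ p := (dist_pos.1 ((hdispl p).symm ▸ hpx)).symm
  rcases h.mem_or_mem hφp with hA | hB
  · have hz' : φ.symm p = z := by
      rw [φ.symm_apply_eq, h.symm.apply_eq φ.isometry (hxz ▸ hdispl) hz hA]
    have hx' : φ.symm x = p := h.apply_eq φ.symm.isometry hdispl' hx (hz' ▸ hz)
    exact Or.inl (φ.symm_apply_eq.1 hx').symm
  · exact Or.inr (φ.symm_apply_eq.2 (h.apply_eq φ.isometry hdispl hx hB).symm)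

theorem not_hasCutPoint_of_isometryEquiv [Nonempty C] (hC : IsRoughlyGeodesic 0 C)
    (H : ∀ r : ℝ, 0 < r → ∃ φ : C ≃ᵢ C, (∀ w, dist w (φ w) = r) ∧
      ∀ p, ∃ x, dist p x = r ∧ φ p ≠ x ∧ φ.symm p ≠ x) : ¬ HasCutPoint C := by
  rintro (hsub | ⟨p, hp⟩)
  · obtain ⟨φ, hφ, -⟩ := H 1 one_pos
    obtain ⟨w⟩ := ‹Nonempty C›
    exact zero_ne_one ((dist_eq_zero.2 (Subsingleton.elim w (φ w))).symm.trans (hφ w))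
  · obtain ⟨A, B, hAB, ⟨u, hu⟩, ⟨v, hv⟩⟩ := hC.exists_isMetricWedge hp
    have hup : u ≠ p := hAB.union_eq.le (Or.inl hu)
    have hvp : v ≠ p := hAB.union_eq.le (Or.inr hv)
    have hr : 0 < min (dist p u) (dist p v) :=
      lt_min (dist_pos.2 hup.symm) (dist_pos.2 hvp.symm)
    obtain ⟨φ, hdispl, hφ⟩ := H _ hr
    obtain ⟨x, hpx, hφx, hφx'⟩ := hφ p
    rw [← hpx] at hr hdispl
    have hne : x ≠ p := (dist_pos.1 hr).symm
    have hx : φ p = x ∨ φ.symm p = x := by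
      rcases hAB.mem_or_mem hne with hxA | hxB
      · obtain ⟨z, hz, hpz⟩ := hAB.exists_mem_dist_eq hC hv hr (hpx.trans_le (min_le_right _ _))
        exact hAB.apply_eq_or_symm_apply_eq hxA hz hpz hr φ hdispl
      · obtain ⟨z, hz, hpz⟩ := hAB.symm.exists_mem_dist_eq hC hu hr
          (hpx.trans_le (min_le_left _ _))
        exact hAB.symm.apply_eq_or_symm_apply_eq hxB hz hpz hr φ hdispl
    exact hx.elim hφx hφx'

end CutPoints

section Ultralimits

variable {I : Type} {ω : Ultrafilter I} {X : I → Type u} [∀ i, MetricSpace (X i)] {e : ∀ i, X i}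

theorem tendsto_dist_mk (x y : FiniteSeq ω X e) :
    Tendsto (fun i => dist (x.1 i) (y.1 i)) (ω : Filter I)
      (𝓝 (dist (SeparationQuotient.mk x) (SeparationQuotient.mk y))) :=
  tendsto_ultraDist x y

theorem mk_ne_mk_of_le_dist (x y : FiniteSeq ω X e) {u : I → ℝ} {r : ℝ} (hr : 0 < r)
    (hu : Tendsto u (ω : Filter I) (𝓝 r)) (h : ∀ i, u i ≤ dist (x.1 i) (y.1 i)) :
    (SeparationQuotient.mk x : Ultralimit ω X e) ≠ SeparationQuotient.mk y :=
  dist_pos.1 (hr.trans_le (le_of_tendsto_of_tendsto' hu (tendsto_dist_mk x y) h))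

theorem FiniteSeq.isBoundedUnder_dist (x : FiniteSeq ω X e) {y : ∀ i, X i}
    (h : IsBoundedUnder (· ≤ ·) (ω : Filter I) fun i => dist (x.1 i) (y i)) :
    IsBoundedUnder (· ≤ ·) (ω : Filter I) fun i => dist (y i) (e i) := by
  obtain ⟨C, hC⟩ := x.2
  obtain ⟨C', hC'⟩ := h
  rw [eventually_map] at hC'
  refine ⟨C' + C, eventually_map.2 ?_⟩
  filter_upwards [hC, hC'] with i hxe hxy
  exact (dist_triangle_left _ _ (x.1 i)).trans (add_le_add hxy hxe)

theorem IsRoughlyGeodesic.ultralimit {δ : I → ℝ} {δ₀ : ℝ}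
    (hX : ∀ i, IsRoughlyGeodesic (δ i) (X i)) (hδ : Tendsto δ (ω : Filter I) (𝓝 δ₀)) :
    IsRoughlyGeodesic δ₀ (Ultralimit ω X e) := by
  intro p q
  obtain ⟨x, rfl⟩ := SeparationQuotient.surjective_mk p
  obtain ⟨y, rfl⟩ := SeparationQuotient.surjective_mk q
  choose γ hγ0 hγ1 hγ using fun i => hX i (x.1 i) (y.1 i)
  have hlim (s t : ℝ) := ((tendsto_dist_mk x y).const_mul |s - t|).add hδ
  have hbdd (t : ℝ) : IsBoundedUnder (· ≤ ·) (ω : Filter I) fun i => dist (γ i t) (e i) :=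
    x.isBoundedUnder_dist <| (hlim 0 t).isBoundedUnder_le.mono_le <|
      Eventually.of_forall fun i => by simpa only [hγ0] using hγ i 0 t
  refine ⟨fun t => SeparationQuotient.mk ⟨fun i => γ i t, hbdd t⟩, ?_, ?_, fun s t => ?_⟩
  · simp only [hγ0]
    rfl
  · simp only [hγ1]
    rfl
  · exact le_of_tendsto_of_tendsto' (tendsto_dist_mk _ _) (hlim s t) fun i => hγ i s t

/-- The map induced on sequences by isometries of the spaces. -/
def FiniteSeq.map (φ : ∀ i, X i ≃ᵢ X i)
    (hφ : IsBoundedUnder (· ≤ ·) (ω : Filter I) fun i => dist (φ i (e i)) (e i))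
    (x : FiniteSeq ω X e) : FiniteSeq ω X e :=
  ⟨fun i => φ i (x.1 i), by
    obtain ⟨C, hC⟩ := x.2
    obtain ⟨C', hC'⟩ := hφ
    rw [eventually_map] at hC'
    refine ⟨C + C', ?_⟩
    filter_upwards [hC, hC'] with i hxe hφe
    refine (dist_triangle _ (φ i (e i)) _).trans (add_le_add ?_ hφe)
    rwa [(φ i).dist_eq]⟩

theorem FiniteSeq.isometry_map (φ : ∀ i, X i ≃ᵢ X i)
    (hφ : IsBoundedUnder (· ≤ ·) (ω : Filter I) fun i => dist (φ i (e i)) (e i)) :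
    Isometry (FiniteSeq.map φ hφ) :=
  Isometry.of_dist_eq fun x y => tendsto_nhds_unique (tendsto_ultraDist _ _)
    ((tendsto_ultraDist x y).congr fun i => ((φ i).dist_eq _ _).symm)

theorem isometry_separationQuotient_map {Y Z : Type*} [PseudoMetricSpace Y] [PseudoMetricSpace Z]
    {f : Y → Z} (hf : Isometry f) : Isometry (SeparationQuotient.map f) := by
  refine Isometry.of_dist_eq (SeparationQuotient.surjective_mk.forall₂.2 fun x y => ?_)
  have hmk := SeparationQuotient.map_mk hf.uniformContinuous
  rw [hmk, hmk, SeparationQuotient.dist_mk, SeparationQuotient.dist_mk, hf.dist_eq]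

theorem isBoundedUnder_dist_symm {l : Filter I} (φ : ∀ i, X i ≃ᵢ X i)
    (hφ : IsBoundedUnder (· ≤ ·) l fun i => dist (φ i (e i)) (e i)) :
    IsBoundedUnder (· ≤ ·) l fun i => dist ((φ i).symm (e i)) (e i) := by
  refine hφ.mono_le (Eventually.of_forall fun i => ?_)
  simp only [← (φ i).dist_eq ((φ i).symm (e i)), (φ i).apply_symm_apply, dist_comm, le_refl]

/-- The isometry of the ultralimit induced by isometries of the spaces which move the observation
point a bounded distance. -/
noncomputable def ultralimitIsometryEquiv (φ : ∀ i, X i ≃ᵢ X i)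
    (hφ : IsBoundedUnder (· ≤ ·) (ω : Filter I) fun i => dist (φ i (e i)) (e i)) :
    Ultralimit ω X e ≃ᵢ Ultralimit ω X e :=
  IsometryEquiv.mk' (SeparationQuotient.map (FiniteSeq.map φ hφ))
    (SeparationQuotient.map (FiniteSeq.map (fun i => (φ i).symm) (isBoundedUnder_dist_symm φ hφ)))
    (SeparationQuotient.surjective_mk.forall.2 fun x => by
      rw [SeparationQuotient.map_mk (FiniteSeq.isometry_map _ _).uniformContinuous,
        SeparationQuotient.map_mk (FiniteSeq.isometry_map _ _).uniformContinuous]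
      exact congrArg _ (Subtype.ext (funext fun i => (φ i).apply_symm_apply _)))
    (isometry_separationQuotient_map (FiniteSeq.isometry_map φ hφ))

theorem ultralimitIsometryEquiv_mk (φ : ∀ i, X i ≃ᵢ X i)
    (hφ : IsBoundedUnder (· ≤ ·) (ω : Filter I) fun i => dist (φ i (e i)) (e i))
    (x : FiniteSeq ω X e) :
    ultralimitIsometryEquiv φ hφ (SeparationQuotient.mk x) =
      SeparationQuotient.mk (FiniteSeq.map φ hφ x) :=
  SeparationQuotient.map_mk (FiniteSeq.isometry_map φ hφ).uniformContinuous x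

theorem ultralimitIsometryEquiv_symm_mk (φ : ∀ i, X i ≃ᵢ X i)
    (hφ : IsBoundedUnder (· ≤ ·) (ω : Filter I) fun i => dist (φ i (e i)) (e i))
    (x : FiniteSeq ω X e) :
    (ultralimitIsometryEquiv φ hφ).symm (SeparationQuotient.mk x) =
      SeparationQuotient.mk
        (FiniteSeq.map (fun i => (φ i).symm) (isBoundedUnder_dist_symm φ hφ) x) :=
  SeparationQuotient.map_mk (FiniteSeq.isometry_map _ _).uniformContinuous x

end Ultralimits
section LeftInvariantMetrics

variable {G : Type*} [Group G] [MetricSpace G] {δ r : ℝ}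

theorem exists_le_dist_one_pow (hball : ∀ R, (Metric.closedBall (1 : G) R).Finite) {a : G}
    (ha : ¬ IsOfFinOrder a) (R : ℝ) : ∃ k : ℕ, R ≤ dist 1 (a ^ k) := by
  by_contra! h
  refine Set.infinite_range_of_injective (injective_pow_iff_not_isOfFinOrder.2 ha)
    ((hball R).subset ?_)
  rintro _ ⟨k, rfl⟩
  exact Metric.mem_closedBall'.2 (h k).le

variable [IsIsometricSMul G G]

theorem dist_self_mul_right (g h : G) : dist g (g * h) = dist 1 h := by
  simpa only [mul_one] using dist_mul_left g 1 h

theorem dist_self_mul_left_of_mem_center {h : G} (hh : h ∈ Subgroup.center G) (g : G) :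
    dist g (h * g) = dist 1 h := by
  rw [← Subgroup.mem_center_iff.1 hh g, dist_self_mul_right]

theorem exists_dist_one_pow_mem_Icc {a : G} (hr : 0 ≤ r) (h : ∃ k : ℕ, r ≤ dist 1 (a ^ k)) :
    ∃ k : ℕ, dist 1 (a ^ k) ∈ Set.Icc r (r + dist 1 a) := by
  classical
  refine ⟨Nat.find h, Nat.find_spec h, ?_⟩
  rcases hk : Nat.find h with _ | k
  · rw [pow_zero, dist_self]
    positivity
  · have hlt : dist 1 (a ^ k) < r := not_le.1 (Nat.find_min h (hk ▸ k.lt_succ_self))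
    calc dist 1 (a ^ (k + 1)) ≤ dist 1 (a ^ k) + dist (a ^ k) (a ^ k * a) := by
          rw [pow_succ]
          exact dist_triangle _ _ _
      _ ≤ r + dist 1 a := by
          rw [dist_self_mul_right]
          gcongr

theorem exists_le_infDist_of_not_finiteIndex (hball : ∀ R, (Metric.closedBall (1 : G) R).Finite)
    {H : Subgroup G} (hH : ¬ H.FiniteIndex) (R : ℝ) : ∃ g : G, R ≤ Metric.infDist g H := by
  by_contra! h
  have := (hball R).to_subtype
  have : Finite (G ⧸ H) := by
    refine Finite.of_surjective
      (fun g : Metric.closedBall (1 : G) R => ((g⁻¹ : G) : G ⧸ H)) fun q => ?_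
    obtain ⟨g, rfl⟩ := QuotientGroup.mk_surjective q
    obtain ⟨x, hx, hdist⟩ := (Metric.infDist_lt_iff ⟨1, H.one_mem⟩).1 (h g⁻¹)
    refine ⟨⟨x⁻¹ * g⁻¹, ?_⟩, ?_⟩
    · rw [Metric.mem_closedBall, ← dist_mul_left x, mul_inv_cancel_left, mul_one]
      exact hdist.le
    · simp only [mul_inv_rev, inv_inv]
      exact QuotientGroup.mk_mul_of_mem g hx
  exact hH Subgroup.finiteIndex_of_finite_quotient

theorem infDist_mul_left_of_mem {H : Subgroup G} {h : G} (hh : h ∈ H) (g : G) :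
    Metric.infDist (h * g) H = Metric.infDist g H := by
  calc Metric.infDist (h * g) H = Metric.infDist (h * g) ((h * ·) '' (H : Set G)) :=
        congrArg _ (smul_coe_set hh).symm
    _ = Metric.infDist g H := Metric.infDist_image (isometry_mul_left h)

/-- The point is taken on a rough geodesic from `H` to a remote point, at distance about `r` from a
starting point which is almost nearest. -/
theorem IsRoughlyGeodesic.exists_le_infDist (hG : IsRoughlyGeodesic δ G) (hδ : 0 < δ)
    {H : Subgroup G} (hr : 0 ≤ r) (hH : ∃ g : G, r ≤ Metric.infDist g H) :
    ∃ g : G, dist 1 g ≤ r + δ ∧ r - 2 * δ ≤ Metric.infDist g H := by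
  have hne : (H : Set G).Nonempty := ⟨1, H.one_mem⟩
  obtain ⟨g, hg⟩ := hH
  obtain ⟨h, hh, hgh⟩ := (Metric.infDist_lt_iff hne).1 (lt_add_of_pos_right (Metric.infDist g H) hδ)
  rw [dist_comm] at hgh
  have hrh : r ≤ dist h g := by
    rw [dist_comm]
    exact hg.trans (Metric.infDist_le_dist_of_mem hh)
  obtain ⟨z, hhz, hzg⟩ := hG.exists_between h g hr hrh
  refine ⟨h⁻¹ * z, ?_, ?_⟩
  · rwa [← dist_mul_left h, mul_one, mul_inv_cancel_left]
  · have := Metric.infDist_le_infDist_add_dist (s := (H : Set G)) (x := g) (y := z)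
    rw [dist_comm g z] at this
    rw [infDist_mul_left_of_mem (H.inv_mem hh)]
    linarith

end LeftInvariantMetrics

section UltralimitsOfGroups

variable {I : Type} {ω : Ultrafilter I} {G : I → Type u} [∀ i, Group (G i)]
  [∀ i, MetricSpace (G i)] [∀ i, IsIsometricSMul (G i) (G i)] {e : ∀ i, G i} {δ : I → ℝ} {r : ℝ}

theorem isBoundedUnder_dist_mulLeft {h : ∀ i, G i} (hc : ∀ i, h i ∈ Subgroup.center (G i))
    (hh : Tendsto (fun i => dist 1 (h i)) (ω : Filter I) (𝓝 r)) :
    IsBoundedUnder (· ≤ ·) (ω : Filter I)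
      fun i => dist (IsometryEquiv.mulLeft (h i) (e i)) (e i) := by
  simpa only [IsometryEquiv.mulLeft_apply, dist_comm _ (e _),
    dist_self_mul_left_of_mem_center (hc _)] using hh.isBoundedUnder_le

theorem dist_ultralimitIsometryEquiv_mulLeft {h : ∀ i, G i}
    (hc : ∀ i, h i ∈ Subgroup.center (G i))
    (hh : Tendsto (fun i => dist 1 (h i)) (ω : Filter I) (𝓝 r)) (p : Ultralimit ω G e) :
    dist p (ultralimitIsometryEquiv (fun i => IsometryEquiv.mulLeft (h i))
      (isBoundedUnder_dist_mulLeft hc hh) p) = r := by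
  obtain ⟨x, rfl⟩ := SeparationQuotient.surjective_mk p
  rw [ultralimitIsometryEquiv_mk]
  exact tendsto_nhds_unique (tendsto_dist_mk _ _)
    (hh.congr fun i => (dist_self_mul_left_of_mem_center (hc i) (x.1 i)).symm)

theorem exists_tendsto_dist_one_pow {a : ∀ i, G i} (hpow : ∀ i R, ∃ k : ℕ, R ≤ dist 1 (a i ^ k))
    (ha : Tendsto (fun i => dist 1 (a i)) (ω : Filter I) (𝓝 0)) (hr : 0 ≤ r) :
    ∃ k : I → ℕ, Tendsto (fun i => dist 1 (a i ^ k i)) (ω : Filter I) (𝓝 r) := by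
  choose k hk using fun i => exists_dist_one_pow_mem_Icc hr (hpow i r)
  have hup : Tendsto (fun i => r + dist 1 (a i)) (ω : Filter I) (𝓝 r) := by
    simpa only [add_zero] using ha.const_add r
  exact ⟨k, tendsto_of_tendsto_of_tendsto_of_le_of_le tendsto_const_nhds hup
    (fun i => (hk i).1) fun i => (hk i).2⟩

theorem exists_tendsto_dist_one_of_infDist {H : ∀ i, Subgroup (G i)}
    (hG : ∀ i, IsRoughlyGeodesic (δ i) (G i)) (hδ : ∀ i, 0 < δ i)
    (hδ0 : Tendsto δ (ω : Filter I) (𝓝 0)) (hH : ∀ i R, ∃ g : G i, R ≤ Metric.infDist g (H i))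
    (hr : 0 ≤ r) :
    ∃ (g : ∀ i, G i) (u : I → ℝ), Tendsto (fun i => dist 1 (g i)) (ω : Filter I) (𝓝 r) ∧
      Tendsto u (ω : Filter I) (𝓝 r) ∧ ∀ i, u i ≤ Metric.infDist (g i) (H i) := by
  choose g hg hgH using fun i => (hG i).exists_le_infDist (hδ i) hr (hH i r)
  have hlow : Tendsto (fun i => r - 2 * δ i) (ω : Filter I) (𝓝 r) := by
    simpa only [mul_zero, sub_zero] using (hδ0.const_mul 2).const_sub r
  have hup : Tendsto (fun i => r + δ i) (ω : Filter I) (𝓝 r) := by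
    simpa only [add_zero] using hδ0.const_add r
  refine ⟨g, _, tendsto_of_tendsto_of_tendsto_of_le_of_le hlow hup (fun i => ?_) hg, hlow, hgH⟩
  rw [dist_comm]
  exact (hgH i).trans (Metric.infDist_le_dist_of_mem (H i).one_mem)

theorem not_hasCutPoint_ultralimit {a : ∀ i, G i} (hG : ∀ i, IsRoughlyGeodesic (δ i) (G i))
    (hδ : ∀ i, 0 < δ i) (hδ0 : Tendsto δ (ω : Filter I) (𝓝 0))
    (hac : ∀ i, a i ∈ Subgroup.center (G i)) (hpow : ∀ i R, ∃ k : ℕ, R ≤ dist 1 (a i ^ k))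
    (hfar : ∀ i R, ∃ g : G i, R ≤ Metric.infDist g (Subgroup.zpowers (a i)))
    (ha : Tendsto (fun i => dist 1 (a i)) (ω : Filter I) (𝓝 0)) :
    ¬ HasCutPoint (Ultralimit ω G e) := by
  have : Nonempty (Ultralimit ω G e) := ⟨SeparationQuotient.mk ⟨e, 0, by simp⟩⟩
  refine not_hasCutPoint_of_isometryEquiv (IsRoughlyGeodesic.ultralimit hG hδ0) fun r hr => ?_
  obtain ⟨k, hk⟩ := exists_tendsto_dist_one_pow hpow ha hr.le
  obtain ⟨g, u, hg, hu, hgu⟩ := exists_tendsto_dist_one_of_infDist hG hδ hδ0 hfar hr.le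
  have hc (i : I) : a i ^ k i ∈ Subgroup.center (G i) := pow_mem (hac i) _
  have hle {h : ∀ i, G i} (hh : ∀ i, h i ∈ Subgroup.zpowers (a i)) (x : ∀ i, G i) (i : I) :
      u i ≤ dist (h i * x i) (x i * g i) := by
    have hhc : h i ∈ Subgroup.center (G i) := Subgroup.zpowers_le.2 (hac i) (hh i)
    rw [← Subgroup.mem_center_iff.1 hhc, dist_mul_left, dist_comm]
    exact (hgu i).trans (Metric.infDist_le_dist_of_mem (hh i))
  refine ⟨ultralimitIsometryEquiv (fun i => IsometryEquiv.mulLeft (a i ^ k i))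
    (isBoundedUnder_dist_mulLeft hc hk), dist_ultralimitIsometryEquiv_mulLeft hc hk,
    SeparationQuotient.surjective_mk.forall.2 fun x => ?_⟩
  have hxg : Tendsto (fun i => dist (x.1 i) (x.1 i * g i)) (ω : Filter I) (𝓝 r) := by
    simpa only [dist_self_mul_right] using hg
  refine ⟨SeparationQuotient.mk
    ⟨fun i => x.1 i * g i, x.isBoundedUnder_dist hxg.isBoundedUnder_le⟩,
    tendsto_nhds_unique (tendsto_dist_mk _ _) hxg, ?_, ?_⟩
  · rw [ultralimitIsometryEquiv_mk]
    exact mk_ne_mk_of_le_dist _ _ hr hu (hle (fun i => Subgroup.npow_mem_zpowers _ _) x.1)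
  · rw [ultralimitIsometryEquiv_symm_mk]
    exact mk_ne_mk_of_le_dist _ _ hr hu
      (hle (fun i => inv_mem (Subgroup.npow_mem_zpowers _ _)) x.1)

end UltralimitsOfGroups

section Rescaling

variable {X : Type u} [MetricSpace X] {d : {r : ℝ // 0 < r}} {δ : ℝ}

theorem IsRoughlyGeodesic.rescaled (hX : IsRoughlyGeodesic δ X) :
    IsRoughlyGeodesic (δ / d) (Rescaled X d) := by
  intro x y
  obtain ⟨γ, hγ0, hγ1, hγ⟩ := hX x y
  refine ⟨γ, hγ0, hγ1, fun s t => ?_⟩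
  calc dist (α := X) (γ s) (γ t) / d ≤ (|s - t| * dist (α := X) x y + δ) / d :=
        div_le_div_of_nonneg_right (hγ s t) d.2.le
    _ = |s - t| * (dist (α := X) x y / d) + δ / d := by rw [add_div, mul_div_assoc]

instance {G : Type u} [Group G] : Group (Rescaled G d) := inferInstanceAs (Group G)

instance {G : Type u} [Group G] [MetricSpace G] [IsIsometricSMul G G] :
    IsIsometricSMul (Rescaled G d) (Rescaled G d) where
  isometry_smul g := Isometry.of_dist_eq fun x y =>
    congrArg (· / (d : ℝ)) (dist_mul_left (M := G) g x y)

theorem finite_closedBall_rescaled {x : X} (hx : ∀ R, (Metric.closedBall x R).Finite) (R : ℝ) :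
    (Metric.closedBall (Rescaled.mk d x) R).Finite :=
  (hx (R * d)).subset fun _ hy => (div_le_iff₀ d.2).1 hy

theorem not_hasCutPoint_scaledUltralimit {I : Type} {ω : Ultrafilter I} {G : I → Type u}
    [∀ i, Group (G i)] [∀ i, MetricSpace (G i)] [∀ i, IsIsometricSMul (G i) (G i)]
    {d : I → {r : ℝ // 0 < r}} {e a : ∀ i, G i} (hG : ∀ i, IsRoughlyGeodesic δ (G i)) (hδ : 0 < δ)
    (hball : ∀ i R, (Metric.closedBall (1 : G i) R).Finite)
    (hac : ∀ i, a i ∈ Subgroup.center (G i)) (ha : ∀ i, ¬ IsOfFinOrder (a i))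
    (hindex : ∀ i, ¬ (Subgroup.zpowers (a i)).FiniteIndex) (hd : ScalingTendsto ω d)
    (had : Tendsto (fun i => dist 1 (a i) / (d i : ℝ)) (ω : Filter I) (𝓝 0)) :
    ¬ HasCutPoint (ScaledUltralimit ω G e d) := by
  have hball' (i : I) (R : ℝ) : (Metric.closedBall (1 : Rescaled (G i) (d i)) R).Finite :=
    finite_closedBall_rescaled (hball i) R
  exact not_hasCutPoint_ultralimit (G := fun i => Rescaled (G i) (d i))
    (fun i => (hG i).rescaled) (fun i => div_pos hδ (d i).2) (hd.const_div_atTop δ) hac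
    (fun i => exists_le_dist_one_pow (hball' i) (ha i))
    (fun i => exists_le_infDist_of_not_finiteIndex (hball' i) (hindex i)) had

end Rescaling

section WordMetrics

variable {G : Type u} [Group G] {S : Set G}

theorem isIsometricSMul_wordMetric (hS : Subgroup.closure S = ⊤) :
    letI := wordMetric S hS
    IsIsometricSMul G G := by
  let _ := wordMetric S hS
  refine ⟨fun g => Isometry.of_dist_eq fun x y => ?_⟩
  change (wordLength S ((g * x)⁻¹ * (g * y)) : ℝ) = wordLength S (x⁻¹ * y)
  rw [mul_inv_rev, mul_assoc, inv_mul_cancel_left]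

theorem exists_geodesic_word (hS : Subgroup.closure S = ⊤) (g : G) :
    ∃ u : ℕ → G, u 0 = 1 ∧ u (wordLength S g) = g ∧
      ∀ m n, m ≤ n → wordLength S ((u m)⁻¹ * u n) ≤ n - m := by
  obtain ⟨l, ⟨hl, hprod⟩, hlen⟩ := exists_word hS g
  refine ⟨fun m => (l.take m).prod, by simp, by simp [← hlen, hprod], fun m n hmn => ?_⟩
  have hsplit : l.take n = l.take m ++ (l.drop m).take (n - m) := by
    rw [← List.take_add, Nat.add_sub_cancel' hmn]
  have hword : IsWordFor S ((l.take m).prod⁻¹ * (l.take n).prod) ((l.drop m).take (n - m)) := by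
    refine ⟨fun x hx => hl x (List.mem_of_mem_drop (List.mem_of_mem_take hx)), ?_⟩
    rw [hsplit, List.prod_append, inv_mul_cancel_left]
  exact (wordLength_le hword).trans (List.length_take_le _ _)

theorem natFloor_sub_natFloor_le {s t : ℝ} (hst : s ≤ t) :
    ((⌊t⌋₊ - ⌊s⌋₊ : ℕ) : ℝ) ≤ t - s + 1 := by
  rw [Nat.cast_sub (Nat.floor_mono hst)]
  rcases le_total 0 t with ht | ht
  · linarith [Nat.floor_le ht, Nat.lt_floor_add_one s]
  · rw [Nat.floor_of_nonpos ht, Nat.floor_of_nonpos (hst.trans ht)]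
    linarith

theorem isRoughlyGeodesic_wordMetric (hS : Subgroup.closure S = ⊤) :
    letI := wordMetric S hS
    IsRoughlyGeodesic 1 G := by
  let _ := wordMetric S hS
  have := isIsometricSMul_wordMetric hS
  intro x y
  obtain ⟨u, hu0, hu1, hu⟩ := exists_geodesic_word hS (x⁻¹ * y)
  have hdist : dist x y = wordLength S (x⁻¹ * y) := rfl
  refine ⟨fun t => x * u ⌊t * dist x y⌋₊, by simp [hu0], by simp [hdist, hu1], fun s t => ?_⟩
  wlog hst : s ≤ t generalizing s t
  · rw [dist_comm, abs_sub_comm]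
    exact this t s (le_of_not_ge hst)
  have hmono : s * dist x y ≤ t * dist x y := mul_le_mul_of_nonneg_right hst dist_nonneg
  calc dist (x * u ⌊s * dist x y⌋₊) (x * u ⌊t * dist x y⌋₊)
      = wordLength S ((u ⌊s * dist x y⌋₊)⁻¹ * u ⌊t * dist x y⌋₊) := dist_mul_left _ _ _
    _ ≤ (⌊t * dist x y⌋₊ - ⌊s * dist x y⌋₊ : ℕ) := Nat.cast_le.2 (hu _ _ (Nat.floor_mono hmono))
    _ ≤ t * dist x y - s * dist x y + 1 := natFloor_sub_natFloor_le hmono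
    _ = |s - t| * dist x y + 1 := by rw [abs_sub_comm, abs_of_nonneg (sub_nonneg.2 hst), sub_mul]

theorem finite_setOf_wordLength_le (hfin : S.Finite) (hS : Subgroup.closure S = ⊤) (n : ℕ) :
    {g : G | wordLength S g ≤ n}.Finite := by
  have hletters : {x : G | x ∈ S ∨ x⁻¹ ∈ S}.Finite :=
    hfin.union (hfin.preimage inv_injective.injOn)
  have := hletters.to_subtype
  refine ((List.finite_length_le {x : G | x ∈ S ∨ x⁻¹ ∈ S} n).image
    fun l => (l.map Subtype.val).prod).subset fun g hg => ?_
  obtain ⟨l, ⟨hl, hprod⟩, hlen⟩ := exists_word hS g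
  lift l to List {x : G | x ∈ S ∨ x⁻¹ ∈ S} using hl
  rw [List.length_map] at hlen
  exact ⟨l, hlen.trans_le hg, hprod⟩

theorem dist_one_wordMetric (hS : Subgroup.closure S = ⊤) (g : G) :
    letI := wordMetric S hS
    dist 1 g = wordLength S g := by
  change (wordLength S (1⁻¹ * g) : ℝ) = wordLength S g
  rw [inv_one, one_mul]

theorem finite_closedBall_wordMetric (hfin : S.Finite) (hS : Subgroup.closure S = ⊤) (R : ℝ) :
    letI := wordMetric S hS
    (Metric.closedBall (1 : G) R).Finite := by
  let _ := wordMetric S hS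
  refine (finite_setOf_wordLength_le hfin hS ⌊R⌋₊).subset fun g hg => Nat.le_floor ?_
  rwa [← dist_one_wordMetric hS, ← Metric.mem_closedBall']

theorem not_hasCutPoint_scaledUltralimit_wordMetric {I : Type} {ω : Ultrafilter I}
    {G : I → Type u} [∀ i, Group (G i)] {S : ∀ i, Set (G i)} {d : I → {r : ℝ // 0 < r}}
    {a : ∀ i, G i} (hfin : ∀ i, (S i).Finite) (hS : ∀ i, Subgroup.closure (S i) = ⊤)
    (hvc : ∀ i, ¬ VirtuallyCyclic (G i)) (hac : ∀ i, a i ∈ Subgroup.center (G i))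
    (ha : ∀ i, ¬ IsOfFinOrder (a i)) (hd : ScalingTendsto ω d)
    (had : Tendsto (fun i => (wordLength (S i) (a i) : ℝ) / (d i : ℝ)) (ω : Filter I) (𝓝 0))
    (e : ∀ i, G i) :
    letI := fun i => wordMetric (S i) (hS i)
    ¬ HasCutPoint (ScaledUltralimit ω G e d) := by
  let _ := fun i => wordMetric (S i) (hS i)
  have (i : I) : IsIsometricSMul (G i) (G i) := isIsometricSMul_wordMetric (hS i)
  refine not_hasCutPoint_scaledUltralimit (fun i => isRoughlyGeodesic_wordMetric (hS i)) one_pos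
    (fun i => finite_closedBall_wordMetric (hfin i) (hS i)) hac ha
    (fun i h => hvc i ⟨_, inferInstance, h⟩) hd ?_
  simpa only [dist_one_wordMetric] using had

end WordMetrics

section CentralFamily

theorem HasCentralInfiniteCyclic.exists_not_isOfFinOrder {G : Type u} [Group G]
    (h : HasCentralInfiniteCyclic G) : ∃ a ∈ Subgroup.center G, ¬ IsOfFinOrder a := by
  obtain ⟨H, hc, hcyc, hinf⟩ := h
  obtain ⟨a, rfl⟩ := (Subgroup.isCyclic_iff_exists_zpowers_eq_top H).1 hcyc
  exact ⟨a, hc (Subgroup.mem_zpowers a), fun ha =>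
    Set.infinite_coe_iff.1 hinf (finite_zpowers.2 ha)⟩

theorem not_hasCutPoint_cone {G : Type u} [Group G] (hvc : ¬ VirtuallyCyclic G)
    (hG : HasCentralInfiniteCyclic G) {S : Set G} (hfin : S.Finite)
    (hS : Subgroup.closure S = ⊤) {I : Type} {ω : Ultrafilter I} {d : I → {r : ℝ // 0 < r}}
    (hd : ScalingTendsto ω d) (e : I → G) :
    letI := wordMetric S hS
    ¬ HasCutPoint (Cone ω G e d) := by
  obtain ⟨a, hac, ha⟩ := hG.exists_not_isOfFinOrder
  exact not_hasCutPoint_scaledUltralimit_wordMetric (fun _ => hfin) (fun _ => hS) (fun _ => hvc)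
    (fun _ => hac) (fun _ => ha) hd (hd.const_div_atTop _) e

theorem exists_nonPrincipal_scalingTendsto (I : Type) [Infinite I] :
    ∃ ω : Ultrafilter I, NonPrincipal ω ∧ ∃ d, ScalingTendsto ω d := by
  let f := Infinite.natEmbedding I
  refine ⟨(hyperfilter ℕ).map f, fun s hs hmem => ?_,
    fun i => ⟨1 + Function.invFun f i, by positivity⟩, ?_⟩
  · exact (hs.preimage f.injective.injOn).notMem_hyperfilter hmem
  · refine tendsto_map'_iff.2 (tendsto_atTop_add_const_left _ _ ?_)
    simp only [Function.leftInverse_invFun f.injective _]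
    exact tendsto_natCast_atTop_atTop.mono_left Nat.hyperfilter_le_atTop

theorem exists_scaling_not_hasCutPoint {I : Type} {ω : Ultrafilter I}
    {d₀ : I → {r : ℝ // 0 < r}} (hd₀ : ScalingTendsto ω d₀) {B : I → MetricSp.{u}}
    (hB : ∀ i, B i ∈ centralFamily) :
    ∃ d : I → {r : ℝ // 0 < r}, ScalingTendsto ω d ∧
      ∀ b : ∀ i, (B i).carrier,
        ¬ HasCutPoint (ScaledUltralimit ω (fun i => (B i).carrier) b d) := by
  choose G hG S hfin hS hvc hcen hBeq using hB
  obtain rfl : B = fun i => @MetricSp.mk (G i) (wordMetric (S i) (hS i)) := funext hBeq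
  choose a hac ha using fun i => (hcen i).exists_not_isOfFinOrder
  let d (i : I) : {r : ℝ // 0 < r} :=
    ⟨(1 + wordLength (S i) (a i)) * d₀ i, mul_pos (by positivity) (d₀ i).2⟩
  have hd : ScalingTendsto ω d := tendsto_atTop_mono
    (fun i => le_mul_of_one_le_left (d₀ i).2.le (by simp)) hd₀
  have had (i : I) : (wordLength (S i) (a i) : ℝ) / d i ≤ (d₀ i : ℝ)⁻¹ := by
    rw [div_le_iff₀ (d i).2, mul_comm, mul_inv_cancel_right₀ (d₀ i).2.ne']
    linarith
  exact ⟨d, hd, not_hasCutPoint_scaledUltralimit_wordMetric hfin hS hvc hac ha hd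
    (squeeze_zero (fun i => div_nonneg (Nat.cast_nonneg _) (d i).2.le) had
      hd₀.inv_tendsto_atTop)⟩

end CentralFamily

end AsympCone

open AsympCone in
theorem mainTheorem11_general :
    (∀ (G : Type u) [Group G], ¬ VirtuallyCyclic G → HasCentralInfiniteCyclic G →
      ∀ (S : Set G) (_ : S.Finite) (hS : Subgroup.closure S = ⊤) (I : Type) (ω : Ultrafilter I)
        (d : I → {r : ℝ // 0 < r}), ScalingTendsto ω d → ∀ e : I → G,
          letI := wordMetric S hS
          ¬ HasCutPoint (Cone ω G e d)) ∧
    ∀ (I : Type) [Infinite I] (B : I → MetricSp.{u}), (∀ i, B i ∈ centralFamily) →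
      ∃ ω : Ultrafilter I, NonPrincipal ω ∧ ∃ d : I → {r : ℝ // 0 < r}, ScalingTendsto ω d ∧
        ∀ b : ∀ i, (B i).carrier,
          ¬ HasCutPoint (ScaledUltralimit ω (fun i => (B i).carrier) b d) := by
  refine ⟨fun G _ hvc hG S hfin hS I ω d hd e => not_hasCutPoint_cone hvc hG hfin hS hd e,
    fun I _ B hB => ?_⟩
  obtain ⟨ω, hω, d₀, hd₀⟩ := exists_nonPrincipal_scalingTendsto I
  exact ⟨ω, hω, exists_scaling_not_hasCutPoint hd₀ hB⟩

theorem mainTheorem11 :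
    (∀ (G : Type u) [Group G], Group.FG G → ¬ AsympCone.VirtuallyCyclic G →
      AsympCone.HasCentralInfiniteCyclic G → AsympCone.WideGroup G) ∧
    AsympCone.UniformlyUnconstricted AsympCone.centralFamily.{u} :=
  ⟨fun G _ _ hvc hG S hfin hS I _ ω _ => mainTheorem11_general.1 G hvc hG S hfin hS I ω,
    fun I _ _ => mainTheorem11_general.2 I⟩
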